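/- **Setting.** A routing problem $G$ consists of a finite directed graph $(V,E)$ (parallel edges allowed), a non-negative non-decreasing latency function $\ell_e:\mathbb{R}_{\ge 0}\to\mathbb{R}_{\ge 0}$ for each edge $e$, and finitely many origin-destination pairs $(o_i,d_i)$, each joined by a non-empty set $\mathcal{P}_i$ of simple paths and carrying a mass $r_i\ge 0$ of infinitesimal users. A feasible flow $f$ distributes, for each $i$, the mass $r_i$ over the paths in $\mathcal{P}_i$; $f_e$ denotes the resulting total mass on edge $e$, and $\mathcal{L}(f)=\sum_{e\in E} f_e\,\ell_e(f_e)$ is the total latency. Given incentive functions $\tau_e:\mathbb{R}_{\ge 0}\to\mathbb{R}$, a feasible flow is a Nash flow if, for each $i$, every path of $\mathcal{P}_i$ carrying positive mass of pair $i$ minimizes $P\mapsto\sum_{e\in P}\bigl(\ell_e(f_e)+\tau_e(f_e)\bigr)$ over $\mathcal{P}_i$ (users are homogeneous). For a family $\mathcal{G}$ of routing problems, a network-agnostic incentive mechanism $T$ assigns to each edge of each problem in $\mathcal{G}$ an incentive function $\tau_e=T(\ell_e)$ (integrable on bounded intervals) that depends only on the latency function $\ell_e$. Its price of anarchy is $$\mathrm{PoA}(\mathcal{G},T)=\sup_{G\in\mathcal{G}}\frac{\sup\{\mathcal{L}(f):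 f\text{ a Nash flow of }G\text{ under }T\}}{\inf\{\mathcal{L}(f): f\text{ a feasible flow of }G\}}$$ (with $0/0=0$, $c/0=\infty$ for $c>0$, and the supremum over an empty set of Nash flows equal to $0$). For $\beta\ge 0$, $T$ is a toll bounded by $\beta$ if $T(\ell_e)[x]\in[0,\beta\,\ell_e(x)]$ for all edges and all $x\ge 0$, and a subsidy bounded by $\beta$ if $T(\ell_e)[x]\in[-\beta\,\ell_e(x),0]$. A bounded network-agnostic toll (subsidy) is optimal if it minimizes $\mathrm{PoA}(\mathcal{G},\cdot)$ among all network-agnostic tolls (subsidies) bounded by $\beta$. Let $\mathcal{G}^{\rm aff}$ be the family of all routing problems in which each latency function has the form $\ell_e(x)=a_e x+b_e$ with $a_e,b_e\ge 0$. **Proposition.** Let $\beta\ge 0$. (1) The mechanism $$T^{\rm opt+}(ax+b;\beta)=\begin{cases}\beta a x,&\beta\in[0,1),\\ a x,&\beta\ge 1,\end{cases}$$ is an optimal network-agnostic toll bounded by $\beta$ in $\mathcal{G}^{\rm aff}$, and $$\mathrm{PoA}(\mathcal{G}^{\rm aff},T^{\rm opt+}(\beta))=\begin{cases}\dfrac{4}{3+2\beta-\beta^2},&\beta\in[0,1),\\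 1,&\beta\ge 1.\end{cases}$$ (2) The mechanism $$T^{\rm opt-}(ax+b;\beta)=\begin{cases}-\beta b,&\beta\in[0,1/2),\\ -b/2,&\beta\ge 1/2,\end{cases}$$ is an optimal network-agnostic subsidy bounded by $\beta$ in $\mathcal{G}^{\rm aff}$, and $$\mathrm{PoA}(\mathcal{G}^{\rm aff},T^{\rm opt-}(\beta))=\begin{cases}\dfrac{4}{3+2\hat\beta-\hat\beta^2},&\beta\in[0,1/2),\\ 1,&\beta\ge 1/2,\end{cases}\qquad \hat\beta=\frac{1}{1-\beta}-1.$$ (3) For every $\beta\in(0,1)$, every optimal network-agnostic toll $T^+$ bounded by $\beta$ and every optimal network-agnostic subsidy $T^-$ bounded by $\beta$ satisfy $$\mathrm{PoA}(\mathcal{G}^{\rm aff},T^+)>\mathrm{PoA}(\mathcal{G}^{\rm aff},T^-).$$ -/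

import Mathlib

open scoped NNReal ENNReal

noncomputable section

namespace CongestionGame

/-- `IsWalk src tgt u p v`: the list `p` of consecutive directed edges leads from `u` to `v`. -/
def IsWalk {V E : Type} (src tgt : E → V) : V → List E → V → Prop
  | u, [], v => u = v
  | u, e :: p, v => src e = u ∧ IsWalk src tgt (tgt e) p v

/-- A simple path from `u` to `v`: a walk that visits no vertex twice. -/
def IsSimplePath {V E : Type} (src tgt : E → V) (u : V) (p : List E) (v : V) : Prop :=
  IsWalk src tgt u p v ∧ (u :: p.map tgt).Nodup

/-- A (non-atomic) routing problem: a finite directed graph (parallel edges allowed), a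
non-negative non-decreasing latency function on each edge, and finitely many
origin-destination pairs, each joined by at least one path and carrying a mass of traffic. -/
structure RoutingProblem where
  /-- vertices -/
  V : Type
  /-- edges -/
  E : Type
  [fintypeV : Fintype V]
  [fintypeE : Fintype E]
  /-- tail of an edge -/
  src : E → V
  /-- head of an edge -/
  tgt : E → V
  /-- latency functions -/
  lat : E → ℝ≥0 → ℝ≥0
  lat_mono : ∀ e, Monotone (lat e)
  /-- number of origin-destination pairs -/
  k : ℕ
  /-- origins -/
  orig : Fin k → V
  /-- destinations -/
  dest : Fin k → V
  /-- masses of traffic -/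
  rate : Fin k → ℝ≥0
  exists_path : ∀ i, ∃ p, IsSimplePath src tgt (orig i) p (dest i)

attribute [instance] RoutingProblem.fintypeV RoutingProblem.fintypeE

namespace RoutingProblem

variable (G : RoutingProblem)

/-- The set of simple paths from the `i`-th origin to the `i`-th destination. -/
abbrev Path (i : Fin G.k) : Type :=
  {p : List G.E // IsSimplePath G.src G.tgt (G.orig i) p (G.dest i)}

instance (i : Fin G.k) : Finite (G.Path i) := by
  classical
  have h : ∀ p : G.Path i, p.1.Nodup := fun p =>
    List.Nodup.of_map G.tgt (List.nodup_cons.1 p.2.2).2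
  exact Finite.of_injective (β := {l : List G.E // l.Nodup}) (fun p => ⟨p.1, h p⟩)
    (fun p q hpq => Subtype.ext (Subtype.mk.inj hpq))

instance (i : Fin G.k) : Fintype (G.Path i) := Fintype.ofFinite _

/-- A flow: the mass of traffic of each origin-destination pair on each of its paths. -/
abbrev Flow : Type := (i : Fin G.k) → G.Path i → ℝ≥0

/-- A flow is feasible if it routes exactly the mass `rate i` of each pair `i`. -/
def Feasible (f : G.Flow) : Prop := ∀ i, ∑ p, f i p = G.rate i

open Classical in
/-- The mass of traffic on the edge `e`. -/
def edgeFlow (f : G.Flow) (e : G.E) : ℝ≥0 :=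
  ∑ i, ∑ p : G.Path i, if e ∈ p.1 then f i p else 0

/-- The total latency of a flow. -/
def totalLatency (f : G.Flow) : ℝ≥0 :=
  ∑ e, G.edgeFlow f e * G.lat e (G.edgeFlow f e)

/-- The cost observed on the path `p` in the flow `f` under the incentives `τ`
(users are homogeneous, with unit sensitivity to incentives). -/
def pathCost (τ : G.E → ℝ≥0 → ℝ) (f : G.Flow) (p : List G.E) : ℝ :=
  (p.map fun e => (G.lat e (G.edgeFlow f e) : ℝ) + τ e (G.edgeFlow f e)).sum

/-- A Nash flow: a feasible flow in which every path in use has minimal observed cost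
among the paths of its origin-destination pair. -/
def IsNash (τ : G.E → ℝ≥0 → ℝ) (f : G.Flow) : Prop :=
  G.Feasible f ∧
    ∀ (i : Fin G.k) (p : G.Path i), 0 < f i p →
      ∀ q : G.Path i, G.pathCost τ f p.1 ≤ G.pathCost τ f q.1

/-- The highest total latency of a Nash flow. -/
def nashLatency (τ : G.E → ℝ≥0 → ℝ) : ℝ≥0∞ :=
  ⨆ (f : G.Flow) (_ : G.IsNash τ f), (G.totalLatency f : ℝ≥0∞)

/-- The total latency of an optimal flow. -/
def optLatency : ℝ≥0∞ :=
  ⨅ (f : G.Flow) (_ : G.Feasible f), (G.totalLatency f : ℝ≥0∞)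

end RoutingProblem

/-- An incentive mechanism assigns an incentive function to every edge of every routing problem;
in general it may depend on the whole problem. -/
abbrev Mechanism : Type 1 := (G : RoutingProblem) → G.E → ℝ≥0 → ℝ

/-- The price of anarchy of a family `𝒢` of routing problems under the mechanism `T`. -/
def poa (𝒢 : Set RoutingProblem) (T : Mechanism) : ℝ≥0∞ :=
  ⨆ G ∈ 𝒢, G.nashLatency (T G) / G.optLatency

/-- On the family `𝒢`, edges with the same latency function get the same incentive function. -/
def IsNetworkAgnostic (𝒢 : Set RoutingProblem) (T : Mechanism) : Prop :=
  ∀ G ∈ 𝒢, ∀ G' ∈ 𝒢, ∀ (e : G.E) (e' : G'.E), G.lat e = G'.lat e' → T G e = T G' e'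

/-- (Local) integrability of an incentive function on the half-line `[0, ∞)`. -/
def IsIntegrableIncentive (τ : ℝ≥0 → ℝ) : Prop :=
  MeasureTheory.LocallyIntegrableOn (fun x : ℝ => τ x.toNNReal) (Set.Ici 0) MeasureTheory.volume

/-- The network-agnostic tolling mechanisms on `𝒢` that are bounded by `β`:
`τ_e(x) ∈ [0, β ℓ_e(x)]`. -/
def boundedTolls (𝒢 : Set RoutingProblem) (β : ℝ) : Set Mechanism :=
  {T | IsNetworkAgnostic 𝒢 T ∧ ∀ G ∈ 𝒢, ∀ e : G.E, IsIntegrableIncentive (T G e) ∧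
    ∀ x, T G e x ∈ Set.Icc 0 (β * G.lat e x)}

/-- The network-agnostic subsidy mechanisms on `𝒢` that are bounded by `β`:
`τ_e(x) ∈ [-β ℓ_e(x), 0]`. -/
def boundedSubsidies (𝒢 : Set RoutingProblem) (β : ℝ) : Set Mechanism :=
  {T | IsNetworkAgnostic 𝒢 T ∧ ∀ G ∈ 𝒢, ∀ e : G.E, IsIntegrableIncentive (T G e) ∧
    ∀ x, T G e x ∈ Set.Icc (-(β * G.lat e x)) 0}

/-- `T` minimizes the price of anarchy of `𝒢` over the set `S` of mechanisms. -/
def IsOptimal (𝒢 : Set RoutingProblem) (S : Set Mechanism) (T : Mechanism) : Prop :=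
  T ∈ S ∧ ∀ T' ∈ S, poa 𝒢 T ≤ poa 𝒢 T'

/-- Affine congestion games: every latency function is `x ↦ a x + b` with `a, b ≥ 0`. -/
def affineGames : Set RoutingProblem :=
  {G | ∀ e : G.E, ∃ a b : ℝ≥0, ∀ x, G.lat e x = a * x + b}

/-- The mechanism that assigns to the latency function `a x + b` the incentive
`k₁ a x + k₂ b`; see `affineMechanism_apply`. -/
def affineMechanism (k₁ k₂ : ℝ) : Mechanism := fun G e x =>
  k₁ * ((G.lat e x : ℝ) - G.lat e 0) + k₂ * G.lat e 0

theorem affineMechanism_apply (k₁ k₂ : ℝ) (G : RoutingProblem) (e : G.E) (a b : ℝ≥0)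
    (h : ∀ x, G.lat e x = a * x + b) (x : ℝ≥0) :
    affineMechanism k₁ k₂ G e x = k₁ * (a * x) + k₂ * b := by
  simp [affineMechanism, h]

end CongestionGame

end

open scoped NNReal ENNReal

/-! Up to the positive factor `1 + k₂`, `affineMechanism k₁ k₂` shows users the edge cost `γ a x +
b` with `γ = (1 + k₁) / (1 + k₂)`, so only `γ` matters. At `γ = 2` this is the marginal cost `2 a x
+ b`, for which Nash flows are optimal; for `0 < γ ≤ 2` the price of anarchy is `4 / (γ (4 - γ))`.

Upper bound (`poa_affineMechanism_le`): add the variational inequality of a Nash flow, suitably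
scaled, to an edgewise quadratic inequality, `affine_smoothness`.

Lower bound (`le_poa_of_pigou`): Pigou's network with latencies `x` and `γ` attains this ratio as
soon as all traffic on the link `x` is a Nash flow. No toll bounded by `β` can prevent this for `γ =
1 + β`, and no subsidy bounded by `β` for `γ = 1 / (1 - β)`. These are the distortions that tolling
`β a x` and subsidizing `β b` achieve, until `γ` reaches `2`. Part (3) follows from `1 + β < 1 / (1
- β)`. -/

namespace CongestionGame

/-! ### Path sums and the variational inequality -/

namespace RoutingProblem

variable (G : RoutingProblem)

/-- Weighting the edges by their flow amounts to weighting the paths by theirs. -/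
theorem sum_edgeFlow_mul (f : G.Flow) (c : G.E → ℝ) :
    ∑ e, (G.edgeFlow f e : ℝ) * c e = ∑ i, ∑ p : G.Path i, (f i p : ℝ) * (p.1.map c).sum := by
  classical
  have hpath : ∀ (i : Fin G.k) (p : G.Path i),
      (p.1.map c).sum = ∑ e, if e ∈ p.1 then c e else 0 := by
    intro i p
    have hp : p.1.Nodup := List.Nodup.of_map G.tgt (List.nodup_cons.1 p.2.2).2
    rw [← List.sum_toFinset c hp, ← Finset.sum_filter]
    congr 1
    ext e
    simp
  have hedge : ∀ e, (G.edgeFlow f e : ℝ) * c e =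
      ∑ i, ∑ p : G.Path i, (f i p : ℝ) * if e ∈ p.1 then c e else 0 := by
    intro e
    simp only [edgeFlow, NNReal.coe_sum, Finset.sum_mul]
    refine Finset.sum_congr rfl fun i _ => Finset.sum_congr rfl fun p _ => ?_
    split_ifs <;> simp
  simp only [hedge, hpath, Finset.mul_sum]
  rw [Finset.sum_comm]
  exact Finset.sum_congr rfl fun i _ => Finset.sum_comm

/-- The variational inequality satisfied by a Nash flow. -/
theorem IsNash.variational {G : RoutingProblem} {τ : G.E → ℝ≥0 → ℝ} {f g : G.Flow}
    (hf : G.IsNash τ f) (hg : G.Feasible g) :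
    ∑ e, (G.edgeFlow f e : ℝ) * ((G.lat e (G.edgeFlow f e) : ℝ) + τ e (G.edgeFlow f e)) ≤
      ∑ e, (G.edgeFlow g e : ℝ) * ((G.lat e (G.edgeFlow f e) : ℝ) + τ e (G.edgeFlow f e)) := by
  rw [sum_edgeFlow_mul, sum_edgeFlow_mul]
  refine Finset.sum_le_sum fun i _ => ?_
  change ∑ p : G.Path i, (f i p : ℝ) * G.pathCost τ f p.1 ≤
    ∑ p : G.Path i, (g i p : ℝ) * G.pathCost τ f p.1
  obtain ⟨p, hp⟩ := G.exists_path i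
  have : Nonempty (G.Path i) := ⟨⟨p, hp⟩⟩
  -- The cost of a cheapest path `q` separates the two sides: paths used by `f` cost no more, paths
  -- used by `g` no less, and both flows carry the same mass.
  obtain ⟨q, hq⟩ := Finite.exists_min fun p : G.Path i => G.pathCost τ f p.1
  have hrate : ∑ p, (f i p : ℝ) = ∑ p, (g i p : ℝ) := by
    exact_mod_cast (hf.1 i).trans (hg i).symm
  calc ∑ p : G.Path i, (f i p : ℝ) * G.pathCost τ f p.1
      ≤ ∑ p : G.Path i, (f i p : ℝ) * G.pathCost τ f q.1 := by
        refine Finset.sum_le_sum fun p _ => ?_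
        rcases eq_or_lt_of_le (zero_le (a := f i p)) with h | h
        · simp [← h]
        · exact mul_le_mul_of_nonneg_left (hf.2 i p h q) (f i p).coe_nonneg
    _ = ∑ p : G.Path i, (g i p : ℝ) * G.pathCost τ f q.1 := by
        rw [← Finset.sum_mul, ← Finset.sum_mul, hrate]
    _ ≤ ∑ p : G.Path i, (g i p : ℝ) * G.pathCost τ f p.1 :=
        Finset.sum_le_sum fun p _ => mul_le_mul_of_nonneg_left (hq p) (g i p).coe_nonneg

/-- The `Fintype` instance on paths comes from `Fintype.ofFinite`, so sums over paths are evaluated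
by transport along an explicit enumeration. -/
theorem sum_path_eq_sum {ι M : Type*} [Fintype ι] [AddCommMonoid M] (i : Fin G.k)
    (φ : ι ≃ G.Path i) (F : G.Path i → M) : ∑ p, F p = ∑ j, F (φ j) :=
  (φ.sum_comp F).symm

theorem coe_totalLatency (f : G.Flow) :
    (G.totalLatency f : ℝ) = ∑ e, (G.edgeFlow f e : ℝ) * G.lat e (G.edgeFlow f e) := by
  simp [totalLatency]

end RoutingProblem

/-! ### Upper bound by smoothness -/

/-- The smoothness inequality of an affine edge: the incentives distort the ratio of the
coefficients by a factor `γ`. -/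
theorem affine_smoothness {C γ a b x y : ℝ} (hC : 1 ≤ C) (hγ : C * (γ * (4 - γ)) = 4)
    (ha : 0 ≤ a) (hb : 0 ≤ b) (hx : 0 ≤ x) :
    x * (a * x + b) + C * ((y - x) * (γ * (a * x) + b)) ≤ C * (y * (a * y + b)) := by
  -- Completing the square in `y`: the `x ^ 2` terms match because `hγ` says `C * γ - 1 = C * γ ^ 2
  -- / 4`.
  have h : C * (y * (a * y + b)) - (x * (a * x + b) + C * ((y - x) * (γ * (a * x) + b))) =
      a * (C * (y - γ * x / 2) ^ 2) + (C - 1) * (b * x) := by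
    linear_combination (a * x ^ 2 / 4) * hγ
  have h₁ : 0 ≤ a * (C * (y - γ * x / 2) ^ 2) := by positivity
  have h₂ : 0 ≤ (C - 1) * (b * x) := mul_nonneg (by linarith) (by positivity)
  linarith

/-- An affine mechanism that distorts the ratio of the coefficients by a factor `γ`
has price of anarchy at most `C = 4 / (γ (4 - γ))`. -/
theorem poa_affineMechanism_le {C γ k₁ k₂ : ℝ} (hC : 1 ≤ C) (hγ : C * (γ * (4 - γ)) = 4)
    (hk₂ : 0 < 1 + k₂) (hk : 1 + k₁ = γ * (1 + k₂)) :
    poa affineGames (affineMechanism k₁ k₂) ≤ ENNReal.ofReal C := by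
  refine iSup₂_le fun G hG => ENNReal.div_le_of_le_mul ?_
  refine iSup₂_le fun f hf => ?_
  rw [RoutingProblem.optLatency, ENNReal.mul_iInf_of_ne
    (ENNReal.ofReal_pos.2 (by linarith)).ne' ENNReal.ofReal_ne_top]
  refine le_iInf fun g => ?_
  by_cases hg : G.Feasible g
  swap
  · rw [iInf_neg hg, ENNReal.mul_top (ENNReal.ofReal_pos.2 (by linarith)).ne']
    exact le_top
  rw [iInf_pos hg, ← ENNReal.ofReal_coe_nnreal, ← ENNReal.ofReal_coe_nnreal,
    ← ENNReal.ofReal_mul (by linarith)]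
  refine ENNReal.ofReal_le_ofReal ?_
  have hvar := hf.variational hg
  rw [RoutingProblem.coe_totalLatency, RoutingProblem.coe_totalLatency, Finset.mul_sum]
  set x : G.E → ℝ := fun e => G.edgeFlow f e with hx
  set y : G.E → ℝ := fun e => G.edgeFlow g e with hy
  set c : G.E → ℝ := fun e => (G.lat e (G.edgeFlow f e) : ℝ) +
    affineMechanism k₁ k₂ G e (G.edgeFlow f e) with hc
  -- The multiplier `C / (1 + k₂)` cancels the common factor `1 + k₂` of the observed costs, leaving
  -- the smoothness inequality.
  have hedge : ∀ e, x e * G.lat e (G.edgeFlow f e) + C / (1 + k₂) * (y e * c e - x e * c e) ≤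
      C * (y e * G.lat e (G.edgeFlow g e)) := by
    intro e
    obtain ⟨a, b, hab⟩ := hG e
    have h := affine_smoothness (y := y e) hC hγ a.coe_nonneg b.coe_nonneg
      (G.edgeFlow f e).coe_nonneg
    have hce : c e = (1 + k₂) * (γ * (a * x e) + b) := by
      simp only [hc, affineMechanism_apply k₁ k₂ G e a b hab, hab, hx]
      push_cast
      linear_combination (a * (G.edgeFlow f e : ℝ)) * hk
    have hscale : C / (1 + k₂) * (y e * c e - x e * c e) =
        C * ((y e - x e) * (γ * (a * x e) + b)) := by
      rw [hce]
      field_simp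
    rw [hscale, hab, hab]
    push_cast
    exact h
  have hsum := Finset.sum_le_sum fun e (_ : e ∈ Finset.univ) => hedge e
  rw [Finset.sum_add_distrib, ← Finset.mul_sum, Finset.sum_sub_distrib] at hsum
  have hnonneg : 0 ≤ C / (1 + k₂) * (∑ e, y e * c e - ∑ e, x e * c e) :=
    mul_nonneg (div_nonneg (by linarith) hk₂.le) (sub_nonneg.2 hvar)
  linarith

/-! ### Lower bounds from parallel links -/

/-- A Nash flow and a feasible flow of one problem bound the price of anarchy from below. -/
theorem le_poa {𝒢 : Set RoutingProblem} {T : Mechanism} {G : RoutingProblem} (hG : G ∈ 𝒢)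
    {f g : G.Flow} (hf : G.IsNash (T G) f) (hg : G.Feasible g) {C : ℝ}
    (hpos : 0 < G.totalLatency g)
    (h : C * G.totalLatency g ≤ G.totalLatency f) : ENNReal.ofReal C ≤ poa 𝒢 T := by
  refine le_trans ?_ (le_iSup₂_of_le G hG le_rfl)
  have hnash : (G.totalLatency f : ℝ≥0∞) ≤ G.nashLatency (T G) := le_iSup₂_of_le f hf le_rfl
  have hopt : G.optLatency ≤ G.totalLatency g := iInf₂_le_of_le g hg le_rfl
  refine le_trans ?_ (ENNReal.div_le_div hnash hopt)
  rw [ENNReal.le_div_iff_mul_le (Or.inl (by exact_mod_cast hpos.ne'))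
    (Or.inl ENNReal.coe_ne_top), ← ENNReal.ofReal_coe_nnreal, ← ENNReal.ofReal_coe_nnreal,
    ← ENNReal.ofReal_mul' (NNReal.coe_nonneg _)]
  exact ENNReal.ofReal_le_ofReal h

section ParallelLinks

variable {E : Type} [Fintype E] [Nonempty E] (lat : E → ℝ≥0 → ℝ≥0) (hlat : ∀ e, Monotone (lat e))

/-- A unit mass of traffic from one vertex to another across parallel links. -/
abbrev parallelLinks : RoutingProblem where
  V := Bool
  E := E
  src _ := false
  tgt _ := true
  lat := lat
  lat_mono := hlat
  k := 1
  orig _ := false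
  dest _ := true
  rate _ := 1
  exists_path _ := ⟨[Classical.arbitrary E], by simp [IsSimplePath, IsWalk]⟩

/-- The paths across parallel links are the links. -/
noncomputable def linkEquivPath (i : Fin (parallelLinks lat hlat).k) : E ≃ (parallelLinks lat hlat).Path i :=
  Equiv.ofBijective
    (fun e => ⟨[e], by simp [IsSimplePath, IsWalk, parallelLinks]⟩) <| by
    constructor
    · intro e e' h
      exact (List.cons.inj (congrArg Subtype.val h)).1
    · rintro ⟨p, hw, hn⟩
      rcases p with _ | ⟨e, _ | ⟨e', p⟩⟩
      · simp [IsWalk, parallelLinks] at hw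
      · exact ⟨e, rfl⟩
      -- A path with two edges would visit the head `true` twice.
      · exact absurd List.mem_cons_self (List.nodup_cons.1 (List.nodup_cons.1 hn).2).1

@[simp]
theorem linkEquivPath_apply_coe (i : Fin (parallelLinks lat hlat).k) (e : E) :
    (linkEquivPath lat hlat i e).1 = [e] := rfl

/-- The flow that puts the mass `w e` on the link `e`. -/
noncomputable def linkFlow (w : E → ℝ≥0) : (parallelLinks lat hlat).Flow :=
  fun i p => w ((linkEquivPath lat hlat i).symm p)

theorem feasible_linkFlow {w : E → ℝ≥0} (hw : ∑ e, w e = 1) :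
    (parallelLinks lat hlat).Feasible (linkFlow lat hlat w) := by
  intro i
  refine ((parallelLinks lat hlat).sum_path_eq_sum i (linkEquivPath lat hlat i) _).trans ?_
  simpa [linkFlow] using hw

theorem edgeFlow_linkFlow (w : E → ℝ≥0) (e : E) :
    (parallelLinks lat hlat).edgeFlow (linkFlow lat hlat w) e = w e := by
  classical
  unfold RoutingProblem.edgeFlow
  refine (Fintype.sum_unique (ι := Fin 1) _).trans ?_
  refine ((parallelLinks lat hlat).sum_path_eq_sum _ (linkEquivPath lat hlat _) _).trans ?_
  simp [linkFlow]

theorem totalLatency_linkFlow (w : E → ℝ≥0) :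
    (parallelLinks lat hlat).totalLatency (linkFlow lat hlat w) = ∑ e, w e * lat e (w e) := by
  refine Finset.sum_congr rfl fun e _ => ?_
  rw [edgeFlow_linkFlow]

theorem isNash_linkFlow {w : E → ℝ≥0} (hw : ∑ e, w e = 1) {τ : E → ℝ≥0 → ℝ}
    (h : ∀ e, 0 < w e → ∀ e', (lat e (w e) : ℝ) + τ e (w e) ≤ lat e' (w e') + τ e' (w e')) :
    (parallelLinks lat hlat).IsNash τ (linkFlow lat hlat w) := by
  refine ⟨feasible_linkFlow lat hlat hw, fun i p hp q => ?_⟩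
  obtain ⟨e, rfl⟩ := (linkEquivPath lat hlat i).surjective p
  obtain ⟨e', rfl⟩ := (linkEquivPath lat hlat i).surjective q
  have he : 0 < w e := by simpa [linkFlow] using hp
  have hcost : ∀ e, (parallelLinks lat hlat).pathCost τ (linkFlow lat hlat w) [e] =
      (lat e (w e) : ℝ) + τ e (w e) := by
    intro e
    unfold RoutingProblem.pathCost
    rw [List.map_singleton, List.sum_singleton, edgeFlow_linkFlow]
  rw [linkEquivPath_apply_coe, linkEquivPath_apply_coe, hcost, hcost]
  exact h e he e'

end ParallelLinks

/-- No mechanism has price of anarchy less than `1` on the affine games. -/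
theorem one_le_poa (T : Mechanism) : 1 ≤ poa affineGames T := by
  -- On a single link of constant latency `1`, the only feasible flow is Nash under any incentive
  -- and optimal.
  have hlat : ∀ e : Unit, Monotone ((fun _ _ => 1 : Unit → ℝ≥0 → ℝ≥0) e) :=
    fun _ => monotone_const
  have hw : ∑ e : Unit, (fun _ => 1 : Unit → ℝ≥0) e = 1 := by simp
  have hlatency := totalLatency_linkFlow _ hlat (fun _ => 1)
  rw [← ENNReal.ofReal_one]
  refine le_poa (G := parallelLinks _ hlat) (fun _ => ⟨0, 1, fun x => by simp⟩)
    (isNash_linkFlow _ hlat hw fun _ _ _ => le_rfl) (feasible_linkFlow _ hlat hw) ?_ ?_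
  · simp [hlatency]
  · simp

/-! ### Pigou's network -/

/-- The latency functions `x` and `γ` of Pigou's network. -/
def pigouLatency (γ : ℝ≥0) (e : Bool) (x : ℝ≥0) : ℝ≥0 := if e then γ else x

theorem monotone_pigouLatency (γ : ℝ≥0) (e : Bool) : Monotone (pigouLatency γ e) := by
  cases e
  · exact fun x y h => by simpa [pigouLatency] using h
  · exact fun x y _ => by simp [pigouLatency]

/-- Pigou's network with links of latencies `x` and `γ`. -/
abbrev pigou (γ : ℝ≥0) : RoutingProblem := parallelLinks (pigouLatency γ) (monotone_pigouLatency γ)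

theorem pigou_mem_affineGames (γ : ℝ≥0) : pigou γ ∈ affineGames := by
  rintro (_ | _)
  · exact ⟨1, 0, fun x => by simp [pigouLatency]⟩
  · exact ⟨0, γ, fun x => by simp [pigouLatency]⟩

/-- If all traffic of Pigou's network may use the link of latency `x`,
the price of anarchy is at least `4 / (γ (4 - γ))`. -/
theorem le_poa_of_pigou {T : Mechanism} {γ : ℝ≥0} (hγ₀ : 0 < γ) (hγ₂ : γ ≤ 2)
    (h : 1 + T (pigou γ) false 1 ≤ γ + T (pigou γ) true 0) :
    ENNReal.ofReal (4 / (γ * (4 - γ))) ≤ poa affineGames T := by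
  have hγ₂' : (γ : ℝ) ≤ 2 := by exact_mod_cast hγ₂
  have hγ₀' : (0 : ℝ) < γ := by exact_mod_cast hγ₀
  have hhalf : γ / 2 ≤ 1 := by
    rw [← NNReal.coe_le_coe]
    push_cast
    linarith
  have hf : ∑ e : Bool, (fun e => if e then 0 else 1 : Bool → ℝ≥0) e = 1 := by simp
  -- Mass `γ / 2` on the link `x` equates the marginal costs `2 y` and `γ`; it is also where the
  -- square in `affine_smoothness` vanishes for `x = 1`.
  have hg : ∑ e : Bool, (fun e => if e then 1 - γ / 2 else γ / 2 : Bool → ℝ≥0) e = 1 := by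
    simp [tsub_add_cancel_of_le hhalf]
  have hgl : (((pigou γ).totalLatency (linkFlow _ _ (fun e => if e then 1 - γ / 2 else γ / 2)) :
      ℝ≥0) : ℝ) = γ * (4 - γ) / 4 := by
    rw [totalLatency_linkFlow]
    simp [pigouLatency, NNReal.coe_sub hhalf]
    ring
  have hfl : (((pigou γ).totalLatency (linkFlow _ _ (fun e => if e then 0 else 1)) :
      ℝ≥0) : ℝ) = 1 := by
    rw [totalLatency_linkFlow]
    simp [pigouLatency]
  have hpos : (0 : ℝ) < γ * (4 - γ) := mul_pos hγ₀' (by linarith)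
  refine le_poa (pigou_mem_affineGames γ)
    (isNash_linkFlow _ (monotone_pigouLatency γ) hf (τ := T (pigou γ)) ?_)
    (feasible_linkFlow _ (monotone_pigouLatency γ) hg) ?_ ?_
  · rintro (_ | _) he (_ | _)
    · exact le_rfl
    · simpa [pigouLatency] using h
    · simp at he
    · exact le_rfl
  · rw [← NNReal.coe_pos]
    exact lt_of_lt_of_eq (by linarith) hgl.symm
  · refine le_of_eq ?_
    refine (congrArg _ hgl).trans (Eq.trans ?_ hfl.symm)
    rw [← mul_div_assoc, div_mul_cancel₀ _ hpos.ne', div_self four_ne_zero]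

/-! ### Admissibility of the affine mechanisms -/

theorem isNetworkAgnostic_affineMechanism (𝒢 : Set RoutingProblem) (k₁ k₂ : ℝ) :
    IsNetworkAgnostic 𝒢 (affineMechanism k₁ k₂) := by
  intro G _ G' _ e e' h
  funext x
  simp [affineMechanism, h]

theorem isIntegrableIncentive_affineMechanism (k₁ k₂ : ℝ) {G : RoutingProblem}
    (hG : G ∈ affineGames) (e : G.E) : IsIntegrableIncentive (affineMechanism k₁ k₂ G e) := by
  obtain ⟨a, b, hab⟩ := hG e
  simp only [IsIntegrableIncentive, affineMechanism_apply k₁ k₂ G e a b hab]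
  refine (Continuous.locallyIntegrable ?_).locallyIntegrableOn _
  have := NNReal.continuous_coe.comp continuous_real_toNNReal
  fun_prop

theorem affineMechanism_mem_boundedTolls {k β : ℝ} (hk : 0 ≤ k) (hkβ : k ≤ β) :
    affineMechanism k 0 ∈ boundedTolls affineGames β := by
  refine ⟨isNetworkAgnostic_affineMechanism _ _ _, fun G hG e =>
    ⟨isIntegrableIncentive_affineMechanism _ _ hG e, fun x => ?_⟩⟩
  obtain ⟨a, b, hab⟩ := hG e
  rw [affineMechanism_apply k 0 G e a b hab, hab]
  push_cast
  have h : k * (a * x : ℝ) ≤ β * (a * x : ℝ) := mul_le_mul_of_nonneg_right hkβ (by positivity)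
  have hb : 0 ≤ β * (b : ℝ) := mul_nonneg (hk.trans hkβ) b.coe_nonneg
  exact ⟨by rw [zero_mul, add_zero]; positivity, by linarith⟩

theorem affineMechanism_mem_boundedSubsidies {k β : ℝ} (hk : 0 ≤ k) (hkβ : k ≤ β) :
    affineMechanism 0 (-k) ∈ boundedSubsidies affineGames β := by
  refine ⟨isNetworkAgnostic_affineMechanism _ _ _, fun G hG e =>
    ⟨isIntegrableIncentive_affineMechanism _ _ hG e, fun x => ?_⟩⟩
  obtain ⟨a, b, hab⟩ := hG e
  rw [affineMechanism_apply 0 (-k) G e a b hab, hab]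
  push_cast
  have h : k * (b : ℝ) ≤ β * (b : ℝ) := mul_le_mul_of_nonneg_right hkβ b.coe_nonneg
  have hb : 0 ≤ k * (b : ℝ) := mul_nonneg hk b.coe_nonneg
  have ha : 0 ≤ β * (a * x : ℝ) := mul_nonneg (hk.trans hkβ) (by positivity)
  exact ⟨by linarith, by linarith⟩

/-! ### Lower bounds for bounded tolls and subsidies -/

theorem one_le_four_div {γ : ℝ} (h₀ : 0 < γ) (h₂ : γ ≤ 2) : 1 ≤ 4 / (γ * (4 - γ)) := by
  rw [one_le_div (mul_pos h₀ (by linarith))]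
  linarith [sq_nonneg (γ - 2)]

theorem four_div_mul_cancel {γ : ℝ} (h₀ : 0 < γ) (h₂ : γ ≤ 2) :
    4 / (γ * (4 - γ)) * (γ * (4 - γ)) = 4 :=
  div_mul_cancel₀ _ (mul_pos h₀ (by linarith)).ne'

/-- A toll raises the unit cost of the fully loaded link `x` to at most `1 + β` and cannot make the
constant link cheaper than its latency, so `γ = 1 + β` keeps all traffic on `x`. -/
theorem le_poa_of_mem_boundedTolls {β : ℝ} (hβ₀ : 0 ≤ β) (hβ₁ : β < 1) {T : Mechanism}
    (hT : T ∈ boundedTolls affineGames β) :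
    ENNReal.ofReal (4 / ((1 + β) * (4 - (1 + β)))) ≤ poa affineGames T := by
  lift β to ℝ≥0 using hβ₀
  have hb := hT.2 (pigou (1 + β)) (pigou_mem_affineGames _)
  have h₁ := ((hb false).2 1).2
  have h₂ := ((hb true).2 0).1
  have hβ₁' : β < 1 := by exact_mod_cast hβ₁
  have hγ : 1 + β ≤ 2 := by
    rw [← one_add_one_eq_two]
    exact add_le_add_right hβ₁'.le 1
  have h := le_poa_of_pigou (T := T) (γ := 1 + β) (by positivity) hγ ?_
  · simpa using h
  · have hlat : (pigou (1 + β)).lat false 1 = 1 := by simp [pigouLatency]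
    rw [hlat] at h₁
    push_cast at h₁ ⊢
    linarith

/-- A subsidy lowers the cost of the constant link to no less than `(1 - β) * γ`, which is `1` for
`γ = 1 / (1 - β)`, and cannot raise the cost of the link `x` above `1`. -/
theorem le_poa_of_mem_boundedSubsidies {β : ℝ} (hβ₁ : β < 1 / 2) {T : Mechanism}
    (hT : T ∈ boundedSubsidies affineGames β) :
    ENNReal.ofReal (4 / (1 / (1 - β) * (4 - 1 / (1 - β)))) ≤ poa affineGames T := by
  have hpos : 0 < 1 - β := by linarith
  have hγ₀ : 0 < 1 / (1 - β) := by positivity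
  have hγ₂ : 1 / (1 - β) ≤ 2 := by
    rw [div_le_iff₀ hpos]
    linarith
  have hγβ : 1 / (1 - β) * (1 - β) = 1 := div_mul_cancel₀ _ hpos.ne'
  generalize 1 / (1 - β) = γ at *
  lift γ to ℝ≥0 using hγ₀.le
  have hb := hT.2 (pigou γ) (pigou_mem_affineGames _)
  have h₁ := ((hb false).2 1).2
  have h₂ := ((hb true).2 0).1
  refine le_poa_of_pigou (by exact_mod_cast hγ₀) (by exact_mod_cast hγ₂) ?_
  have hlat : (pigou γ).lat true 0 = γ := by simp [pigouLatency]
  rw [hlat] at h₂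
  linarith

/-! ### Optimality and comparison -/

/-- A mechanism whose price of anarchy is a lower bound for all of `S` is optimal, and every
optimal mechanism attains that bound. -/
theorem isOptimal_and_poa_eq {𝒢 : Set RoutingProblem} {S : Set Mechanism} {T : Mechanism}
    {c : ℝ≥0∞} (hT : T ∈ S) (hle : poa 𝒢 T ≤ c) (hge : ∀ T' ∈ S, c ≤ poa 𝒢 T') :
    IsOptimal 𝒢 S T ∧ poa 𝒢 T = c :=
  ⟨⟨hT, fun T' hT' => hle.trans (hge T' hT')⟩, le_antisymm hle (hge T hT)⟩

theorem IsOptimal.poa_eq {𝒢 : Set RoutingProblem} {S : Set Mechanism} {T T' : Mechanism}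
    (h : IsOptimal 𝒢 S T) (h' : IsOptimal 𝒢 S T') : poa 𝒢 T = poa 𝒢 T' :=
  le_antisymm (h.2 T' h'.1) (h'.2 T h.1)

theorem optimal_toll {β : ℝ} (hβ : 0 ≤ β) :
    IsOptimal affineGames (boundedTolls affineGames β)
        (if β < 1 then affineMechanism β 0 else affineMechanism 1 0) ∧
      poa affineGames (if β < 1 then affineMechanism β 0 else affineMechanism 1 0) =
        if β < 1 then ENNReal.ofReal (4 / (3 + 2 * β - β ^ 2)) else 1 := by
  split_ifs with h
  · rw [show 3 + 2 * β - β ^ 2 = (1 + β) * (4 - (1 + β)) by ring]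
    exact isOptimal_and_poa_eq (affineMechanism_mem_boundedTolls hβ le_rfl)
      (poa_affineMechanism_le (one_le_four_div (by linarith) (by linarith))
        (four_div_mul_cancel (by linarith) (by linarith)) (by norm_num) (by ring))
      fun T hT => le_poa_of_mem_boundedTolls hβ h hT
  · refine isOptimal_and_poa_eq (affineMechanism_mem_boundedTolls zero_le_one (not_lt.1 h)) ?_
      fun T _ => one_le_poa T
    rw [← ENNReal.ofReal_one]
    -- Marginal-cost tolling: `γ = 2` gives `C = 1`.
    exact poa_affineMechanism_le (γ := 2) le_rfl (by norm_num) (by norm_num) (by norm_num)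

theorem optimal_subsidy {β : ℝ} (hβ : 0 ≤ β) :
    IsOptimal affineGames (boundedSubsidies affineGames β)
        (if β < 1 / 2 then affineMechanism 0 (-β) else affineMechanism 0 (-(1 / 2))) ∧
      poa affineGames
          (if β < 1 / 2 then affineMechanism 0 (-β) else affineMechanism 0 (-(1 / 2))) =
        if β < 1 / 2 then
          ENNReal.ofReal
            (4 / (3 + 2 * (1 / (1 - β) - 1) - (1 / (1 - β) - 1) ^ 2))
        else 1 := by
  split_ifs with h
  -- With `γ = 1 / (1 - β)`, the effective bound `γ - 1` plays the role of `β` in the toll formula.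
  · rw [show 3 + 2 * (1 / (1 - β) - 1) - (1 / (1 - β) - 1) ^ 2 =
      1 / (1 - β) * (4 - 1 / (1 - β)) by ring]
    have hpos : 0 < 1 - β := by linarith
    have hγ₀ : 0 < 1 / (1 - β) := by positivity
    have hγ₂ : 1 / (1 - β) ≤ 2 := by
      rw [div_le_iff₀ hpos]
      linarith
    refine isOptimal_and_poa_eq (affineMechanism_mem_boundedSubsidies hβ le_rfl)
      (poa_affineMechanism_le (one_le_four_div hγ₀ hγ₂)
        (four_div_mul_cancel hγ₀ hγ₂) (by linarith) ?_)
      fun T hT => le_poa_of_mem_boundedSubsidies h hT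
    rw [← sub_eq_add_neg, div_mul_cancel₀ _ hpos.ne', add_zero]
  · refine isOptimal_and_poa_eq
      (affineMechanism_mem_boundedSubsidies (by norm_num) (not_lt.1 h)) ?_ fun T _ => one_le_poa T
    rw [← ENNReal.ofReal_one]
    -- The observed cost `a x + b / 2` is half the marginal cost, so again `γ = 2`.
    exact poa_affineMechanism_le (γ := 2) le_rfl (by norm_num) (by norm_num) (by norm_num)

/-- The optimal subsidy has a smaller price of anarchy than the optimal toll. -/
theorem subsidy_value_lt_toll_value {β : ℝ} (hβ₀ : 0 < β) (hβ₁ : β < 1) :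
    (if β < 1 / 2 then
      ENNReal.ofReal (4 / (3 + 2 * (1 / (1 - β) - 1) - (1 / (1 - β) - 1) ^ 2)) else 1) <
      ENNReal.ofReal (4 / (3 + 2 * β - β ^ 2)) := by
  have htoll : 0 < 3 + 2 * β - β ^ 2 := by nlinarith
  split_ifs with h
  · have hpos : 0 < 1 - β := by linarith
    have hle : 1 / (1 - β) - 1 ≤ 1 := by
      rw [sub_le_iff_le_add, div_le_iff₀ hpos]
      linarith
    have hlt : β < 1 / (1 - β) - 1 := by
      rw [lt_sub_iff_add_lt, lt_div_iff₀ hpos]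
      nlinarith
    generalize 1 / (1 - β) - 1 = γ at *
    refine (ENNReal.ofReal_lt_ofReal_iff (by positivity)).2 ?_
    -- `3 + 2 t - t ^ 2` is strictly increasing for `t ≤ 1`, and `β < γ ≤ 1`, where `γ` now names `1
    -- / (1 - β) - 1`.
    exact div_lt_div_of_pos_left (by norm_num) htoll (by nlinarith)
  · rw [← ENNReal.ofReal_one]
    refine (ENNReal.ofReal_lt_ofReal_iff (by positivity)).2 ?_
    -- What remains is `0 < (1 - β) ^ 2`.
    rw [one_lt_div htoll]
    nlinarith

end CongestionGame

open CongestionGame in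
theorem proposition1 (β : ℝ) (hβ : 0 ≤ β) :
    -- the optimal bounded toll and its price of anarchy
    (IsOptimal affineGames (boundedTolls affineGames β)
        (if β < 1 then affineMechanism β 0 else affineMechanism 1 0) ∧
      poa affineGames (if β < 1 then affineMechanism β 0 else affineMechanism 1 0) =
        if β < 1 then ENNReal.ofReal (4 / (3 + 2 * β - β ^ 2)) else 1) ∧
    -- the optimal bounded subsidy and its price of anarchy
    (IsOptimal affineGames (boundedSubsidies affineGames β)
        (if β < 1 / 2 then affineMechanism 0 (-β) else affineMechanism 0 (-(1 / 2))) ∧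
      poa affineGames
          (if β < 1 / 2 then affineMechanism 0 (-β) else affineMechanism 0 (-(1 / 2))) =
        if β < 1 / 2 then
          ENNReal.ofReal
            (4 / (3 + 2 * (1 / (1 - β) - 1) - (1 / (1 - β) - 1) ^ 2))
        else 1) ∧
    -- optimal subsidies strictly outperform optimal tolls
    (0 < β → β < 1 → ∀ Tplus Tminus : Mechanism,
      IsOptimal affineGames (boundedTolls affineGames β) Tplus →
      IsOptimal affineGames (boundedSubsidies affineGames β) Tminus →
      poa affineGames Tminus < poa affineGames Tplus) := by
  refine ⟨optimal_toll hβ, optimal_subsidy hβ, fun hβ₀ hβ₁ Tplus Tminus hplus hminus => ?_⟩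
  obtain ⟨htoll, htoll_eq⟩ := optimal_toll hβ
  obtain ⟨hsub, hsub_eq⟩ := optimal_subsidy hβ
  rw [hminus.poa_eq hsub, hplus.poa_eq htoll, hsub_eq, htoll_eq, if_pos hβ₁]
  exact subsidy_value_lt_toll_value hβ₀ hβ₁
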